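/- Let $\mathcal X\subset\mathbb R^d$ be compact, let $k:\mathcal X\times\mathcal X\to\mathbb R$ be a (measurable) positive semidefinite kernel with $k(x,x')\le 1$ for all $x,x'\in\mathcal X$, and let $f$ belong to the reproducing kernel Hilbert space $\mathcal H_k$ of $k$ with $\|f\|_k\le B$. Let $(\mathcal F_t)_{t\ge 0}$ be a filtration on a probability space. In round $t=1,\dots,T$ (with $T\ge1$) an $\mathcal F_{t-1}$-measurable point $x_t\in\mathcal X$ is queried and $y_t=f(x_t)+\epsilon_t$ is observed, where $\epsilon_t$ is $\mathcal F_t$-measurable and conditionally $R$-sub-Gaussian: $\mathbb E[\exp(\eta\epsilon_t)\mid\mathcal F_{t-1}]\le\exp(\eta^2R^2/2)$ for all $\eta\in\mathbb R$. Let $\sigma>0$ with $0\le R\le\sigma$, and let $$\mu_{t-1}(x)=\mathbf k_{t-1}(x)^\top(\mathbf K_{t-1}+\sigma^2\mathbf I)^{-1}\mathbf y_{t-1},\qquad \sigma_{t-1}^2(x)=k(x,x)-\mathbf k_{t-1}(x)^\top(\mathbf K_{t-1}+\sigma^2\mathbf I)^{-1}\mathbf k_{t-1}(x)$$ be the Gaussian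 process predictive mean and variance, where $\mathbf K_{t-1}=[k(x_i,x_j)]_{i,j=1}^{t-1}$, $\mathbf k_{t-1}(x)=[k(x_i,x)]_{i=1}^{t-1}$ and $\mathbf y_{t-1}=(y_1,\dots,y_{t-1})^\top$. Let $$\gamma_t=\sup_{a_1,\dots,a_t\in\mathcal X}\tfrac12\log\det\bigl(\mathbf I+\sigma^{-2}[k(a_i,a_j)]_{i,j=1}^t\bigr)$$ be the maximum information gain. Fix $\delta\in(0,1)$ and let $\beta_1,\dots,\beta_T$ be real numbers with $$\beta_t\ \ge\ 2B^2+300\,\gamma_t\,\log^3(t/\delta),\qquad 1\le t\le T$$ (for instance with equality). Suppose that the queries are those of GP-UCB with the fixed kernel $k$, i.e. $x_t\in\arg\max_{x\in\mathcal X}\ \mu_{t-1}(x)+\beta_t^{1/2}\sigma_{t-1}(x)$ for $1\le t\le T$. Put $C_t^f(x)=\{z\in\mathbb R:|z-\mu_{t-1}(x)|\le\beta_t^{1/2}\sigma_{t-1}(x)\}$ and $$\hat p_T^f=\frac1T\sum_{t=1}^T\mathbb 1\bigl[f(x_t)\in C_t^f(x_t)\bigr].$$ Then $\mathbb P\bigl(\hat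 p_T^f\ge 1-\delta\bigr)\ge 1-\delta$. -/

import Mathlib

open MeasureTheory ProbabilityTheory
open scoped Matrix

noncomputable section

namespace GPUCB

variable {X : Type*}

/-- The Gram matrix `K = [k(a_i, a_j)]` of a tuple of points. -/
def gram (k : X → X → ℝ) {n : ℕ} (a : Fin n → X) : Matrix (Fin n) (Fin n) ℝ :=
  Matrix.of fun i j => k (a i) (a j)

/-- The regularised Gram matrix `K + σ² I`. -/
def regGram (k : X → X → ℝ) (σ : ℝ) {n : ℕ} (a : Fin n → X) : Matrix (Fin n) (Fin n) ℝ :=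
  gram k a + σ ^ 2 • (1 : Matrix (Fin n) (Fin n) ℝ)

/-- The vector `k(z) = [k(a_i, z)]`. -/
def kvec (k : X → X → ℝ) {n : ℕ} (a : Fin n → X) (z : X) : Fin n → ℝ :=
  fun i => k (a i) z

/-- GP predictive mean `k(z)ᵀ (K + σ² I)⁻¹ y` after observing `y` at the points `a`. -/
def postMean (k : X → X → ℝ) (σ : ℝ) {n : ℕ} (a : Fin n → X) (y : Fin n → ℝ) (z : X) : ℝ :=
  kvec k a z ⬝ᵥ ((regGram k σ a)⁻¹ *ᵥ y)

/-- GP predictive variance `k(z, z) - k(z)ᵀ (K + σ² I)⁻¹ k(z)`. -/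
def postVar (k : X → X → ℝ) (σ : ℝ) {n : ℕ} (a : Fin n → X) (z : X) : ℝ :=
  k z z - kvec k a z ⬝ᵥ ((regGram k σ a)⁻¹ *ᵥ kvec k a z)

/-- GP predictive standard deviation. -/
def postStd (k : X → X → ℝ) (σ : ℝ) {n : ℕ} (a : Fin n → X) (z : X) : ℝ :=
  √(postVar k σ a z)

/-- Maximum information gain after `t` evaluations: the supremum of `½ log det (I + σ⁻² K_A)` over
all choices `A` of `t` points, repetitions allowed. For a positive semidefinite kernel with
`k ≤ 1` it is at most `½ t log (1 + σ⁻²)`, so the supremum is a genuine one. -/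
def infoGain (k : X → X → ℝ) (σ : ℝ) (t : ℕ) : ℝ :=
  ⨆ a : Fin t → X,
    (1 / 2) * Real.log (1 + (σ ^ 2)⁻¹ • gram k a : Matrix (Fin t) (Fin t) ℝ).det

/-- The exploration scale `2 B² + 300 γ_t log³(t / δ)`. -/
def ucbScale (k : X → X → ℝ) (σ B δ : ℝ) (t : ℕ) : ℝ :=
  2 * B ^ 2 + 300 * infoGain k σ t * Real.log (t / δ) ^ 3

variable {Ω : Type*}

/-- The first `n` queries `x_1, …, x_n` along the outcome `ω`. -/
def queries (x : ℕ → Ω → X) (n : ℕ) (ω : Ω) : Fin n → X :=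
  fun i => x (i + 1) ω

/-- The first `n` observations `y_i = f(x_i) + ε_i`, `1 ≤ i ≤ n`, along the outcome `ω`. -/
def observations (f : X → ℝ) (x : ℕ → Ω → X) (ε : ℕ → Ω → ℝ) (n : ℕ) (ω : Ω) : Fin n → ℝ :=
  fun i => f (x (i + 1) ω) + ε (i + 1) ω

/-- `μ_{t-1}(z)` at round `t` of a run (for `t ≥ 1`). -/
def runMean (k : X → X → ℝ) (σ : ℝ) (f : X → ℝ) (x : ℕ → Ω → X) (ε : ℕ → Ω → ℝ)
    (t : ℕ) (ω : Ω) (z : X) : ℝ :=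
  postMean k σ (queries x (t - 1) ω) (observations f x ε (t - 1) ω) z

/-- `σ_{t-1}(z)` at round `t` of a run (for `t ≥ 1`). -/
def runStd (k : X → X → ℝ) (σ : ℝ) (x : ℕ → Ω → X) (t : ℕ) (ω : Ω) (z : X) : ℝ :=
  postStd k σ (queries x (t - 1) ω) z

/-- In each of the rounds `1, …, T` the query maximises the upper confidence bound
`z ↦ μ_{t-1}(z) + √β_t σ_{t-1}(z)`. -/
def IsUCBRun (k : X → X → ℝ) (σ : ℝ) (β : ℕ → ℝ) (f : X → ℝ) (x : ℕ → Ω → X)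
    (ε : ℕ → Ω → ℝ) (T : ℕ) : Prop :=
  ∀ t ∈ Finset.Icc 1 T, ∀ ω, ∀ z : X,
    runMean k σ f x ε t ω z + √(β t) * runStd k σ x t ω z ≤
      runMean k σ f x ε t ω (x t ω) + √(β t) * runStd k σ x t ω (x t ω)

/-- The noise `ε_1, …, ε_T` is adapted and conditionally `R`-sub-Gaussian:
`E[exp(η ε_t) | ℱ_{t-1}] ≤ exp(η² R² / 2)` for all real `η`. -/
def IsCondSubGaussianNoise {mΩ : MeasurableSpace Ω} (P : Measure Ω) (ℱ : Filtration ℕ mΩ) (R : ℝ)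
    (ε : ℕ → Ω → ℝ) (T : ℕ) : Prop :=
  ∀ t ∈ Finset.Icc 1 T, Measurable[ℱ t] (ε t) ∧
    ∀ η : ℝ, Integrable (fun ω => Real.exp (η * ε t ω)) P ∧
      P[fun ω => Real.exp (η * ε t ω) | ℱ (t - 1)] ≤ᵐ[P] fun _ => Real.exp (η ^ 2 * R ^ 2 / 2)

/-- The function-level set `C_t^f(v) = {z : |z - μ_{t-1}(v)| ≤ √β_t σ_{t-1}(v)}`. -/
def coverageSet (k : X → X → ℝ) (σ : ℝ) (β : ℕ → ℝ) (f : X → ℝ) (x : ℕ → Ω → X)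
    (ε : ℕ → Ω → ℝ) (t : ℕ) (ω : Ω) (v : X) : Set ℝ :=
  {z | |z - runMean k σ f x ε t ω v| ≤ √(β t) * runStd k σ x t ω v}

/-- The function-level long-run coverage `(1 / T) ∑_{t=1}^T 𝟙[f(x_t) ∈ C_t^f(x_t)]`. -/
def coverage (k : X → X → ℝ) (σ : ℝ) (β : ℕ → ℝ) (f : X → ℝ) (x : ℕ → Ω → X)
    (ε : ℕ → Ω → ℝ) (T : ℕ) (ω : Ω) : ℝ :=
  (1 / (T : ℝ)) * ∑ t ∈ Finset.Icc 1 T,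
    (coverageSet k σ β f x ε t ω (x t ω)).indicator (fun _ => (1 : ℝ)) (f (x t ω))

end GPUCB

end

/-! With probability at least `1 - δ` every round is covered, and then the coverage equals `1`.
Write `Z_s = eᵀ K (K + s² I)⁻¹ e` for the self-normalised noise. The prediction error is at most
`‖f‖ + √Z_σ / σ` posterior standard deviations (`abs_sub_postMean_le`). Since `(a + b)² ≤ 2a² +
2b²`, round `t` is covered as soon as `Z_σ / σ² ≤ 150 γ_t L³` with `L = log (t / δ)`
(`mem_coverageSet`). A union bound with failure probabilities `δ / t²` handles all rounds together.

The tail of `Z_s` comes from the method of mixtures. For every `s > 0`, `exp (Z_s / (2σ²)) / √det (I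
+ s⁻² K)` has mean at most `1`: a new observation multiplies it by a Gaussian average of
sub-Gaussian likelihood ratios (`mixture_succ`, `lintegral_mul_mixture_le`). Markov's inequality
with `s = σ` gives `Z_σ / σ² ≤ 2γ + 4L`, which suffices when `γ ≥ 1/16`.

For small `γ` the term `4L` is not absorbed by a multiple of `γ`. But then the trace of `K` is at
most `3γσ²`. Taking `s² = 3γσ²` in the mixture keeps `log det (I + s⁻² K) ≤ 1`, and the comparison
`Z_σ ≤ 6γ Z_s` supplies the missing factor (`measure_selfNorm_gt_infoGain_le`). -/

namespace GPUCB

/-! ### Ridge regression in feature space. -/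

section LinearAlgebra

variable {X H : Type*} [NormedAddCommGroup H] [InnerProductSpace ℝ H]

/-- The kernel `k` is represented by the feature map `φ`. -/
def IsFeature (k : X → X → ℝ) (φ : X → H) : Prop :=
  ∀ z z', k z z' = inner ℝ (φ z) (φ z')

/-- The linear combination `∑ wᵢ φ(aᵢ)`. -/
noncomputable def comb (φ : X → H) {n : ℕ} (a : Fin n → X) (w : Fin n → ℝ) : H :=
  ∑ i, w i • φ (a i)

/-- The ridge coefficients `(K + s² I)⁻¹ y`. -/
noncomputable def coef (k : X → X → ℝ) (s : ℝ) {n : ℕ} (a : Fin n → X) (y : Fin n → ℝ) :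
    Fin n → ℝ :=
  (regGram k s a)⁻¹ *ᵥ y

/-- The self-normalised noise `eᵀ K (K + s² I)⁻¹ e = eᵀ e - s² eᵀ (K + s² I)⁻¹ e`. -/
noncomputable def selfNorm (k : X → X → ℝ) (s : ℝ) {n : ℕ} (a : Fin n → X) (e : Fin n → ℝ) : ℝ :=
  e ⬝ᵥ e - s ^ 2 * (e ⬝ᵥ coef k s a e)

/-- The determinant `det (I + s⁻² K)`. -/
noncomputable def gainDet (k : X → X → ℝ) (s : ℝ) {n : ℕ} (a : Fin n → X) : ℝ :=
  (1 + (s ^ 2)⁻¹ • gram k a : Matrix (Fin n) (Fin n) ℝ).det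

variable {k : X → X → ℝ} {φ : X → H} {s : ℝ} {n : ℕ}

lemma inner_feature_comb (hφ : IsFeature k φ) (a : Fin n → X) (w : Fin n → ℝ) (z : X) :
    inner ℝ (φ z) (comb φ a w) = kvec k a z ⬝ᵥ w := by
  simp only [comb, inner_sum, inner_smul_right, dotProduct, kvec]
  refine Finset.sum_congr rfl fun i _ => ?_
  rw [hφ, real_inner_comm, mul_comm]

lemma gram_mulVec_apply (hφ : IsFeature k φ) (a : Fin n → X) (w : Fin n → ℝ) (i : Fin n) :
    (gram k a *ᵥ w) i = inner ℝ (φ (a i)) (comb φ a w) := by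
  simp only [comb, inner_sum, inner_smul_right, Matrix.mulVec, dotProduct, gram, Matrix.of_apply]
  refine Finset.sum_congr rfl fun j _ => ?_
  rw [hφ, mul_comm]

lemma inner_comb_comb (hφ : IsFeature k φ) (a : Fin n → X) (v w : Fin n → ℝ) :
    inner ℝ (comb φ a v) (comb φ a w) = v ⬝ᵥ (gram k a *ᵥ w) := by
  conv_lhs => rw [comb, sum_inner]
  simp only [inner_smul_left, dotProduct, gram_mulVec_apply hφ, RCLike.conj_to_real]

lemma regGram_posDef (hφ : IsFeature k φ) (hs : 0 < s) (a : Fin n → X) :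
    (regGram k s a).PosDef := by
  have hg : gram k a = Matrix.gram ℝ (fun i => φ (a i)) := by
    ext i j
    simp [gram, Matrix.gram_apply, hφ (a i) (a j)]
  rw [regGram, hg]
  refine Matrix.PosDef.posSemidef_add (Matrix.posSemidef_gram ℝ _) ?_
  exact Matrix.PosDef.one.smul (pow_pos hs 2)

lemma regGram_isUnit (hφ : IsFeature k φ) (hs : 0 < s) (a : Fin n → X) :
    IsUnit (regGram k s a).det :=
  (Matrix.isUnit_iff_isUnit_det _).1 (regGram_posDef hφ hs a).isUnit

lemma regGram_mulVec (a : Fin n → X) (w : Fin n → ℝ) :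
    regGram k s a *ᵥ w = gram k a *ᵥ w + s ^ 2 • w := by
  rw [regGram, Matrix.add_mulVec, Matrix.smul_mulVec, Matrix.one_mulVec]

lemma regGram_mulVec_coef (hφ : IsFeature k φ) (hs : 0 < s) (a : Fin n → X) (y : Fin n → ℝ) :
    regGram k s a *ᵥ coef k s a y = y := by
  rw [coef, Matrix.mulVec_mulVec, Matrix.mul_nonsing_inv _ (regGram_isUnit hφ hs a),
    Matrix.one_mulVec]

lemma coef_eq_of_mulVec (hφ : IsFeature k φ) (hs : 0 < s) (a : Fin n → X) {y w : Fin n → ℝ}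
    (h : regGram k s a *ᵥ w = y) : coef k s a y = w := by
  rw [coef, ← h, Matrix.mulVec_mulVec, Matrix.nonsing_inv_mul _ (regGram_isUnit hφ hs a),
    Matrix.one_mulVec]

lemma gram_mulVec_coef (hφ : IsFeature k φ) (hs : 0 < s) (a : Fin n → X) (y : Fin n → ℝ) :
    gram k a *ᵥ coef k s a y = y - s ^ 2 • coef k s a y := by
  rw [eq_sub_iff_add_eq, ← regGram_mulVec, regGram_mulVec_coef hφ hs]

lemma regGram_isSymm (hφ : IsFeature k φ) (a : Fin n → X) : (regGram k s a)ᵀ = regGram k s a := by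
  have h : (gram k a)ᵀ = gram k a := by
    ext i j
    simp only [gram, Matrix.transpose_apply, Matrix.of_apply]
    rw [hφ, hφ, real_inner_comm]
  rw [regGram, Matrix.transpose_add, Matrix.transpose_smul, Matrix.transpose_one, h]

lemma dotProduct_coef_comm (hφ : IsFeature k φ) (a : Fin n → X) (u v : Fin n → ℝ) :
    u ⬝ᵥ coef k s a v = v ⬝ᵥ coef k s a u := by
  rw [coef, coef, Matrix.dotProduct_mulVec, dotProduct_comm, ← Matrix.mulVec_transpose,
    Matrix.transpose_nonsing_inv, regGram_isSymm hφ]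

lemma selfNorm_eq (hφ : IsFeature k φ) (hs : 0 < s) (a : Fin n → X) (e : Fin n → ℝ) :
    selfNorm k s a e = inner ℝ (comb φ a e) (comb φ a (coef k s a e)) := by
  rw [inner_comb_comb hφ, gram_mulVec_coef hφ hs, dotProduct_sub, dotProduct_smul, selfNorm,
    smul_eq_mul]

/-- Substitute `e = (K + s² I) w`. The result is the squared norm of the pair `(∑ wᵢ φ(aᵢ), K w)` in
`H ⊕ ℝⁿ` with weight `s²` on `H`, ready for Cauchy–Schwarz. -/
lemma selfNorm_eq_sq (hφ : IsFeature k φ) (hs : 0 < s) (a : Fin n → X) (e : Fin n → ℝ) :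
    selfNorm k s a e = s ^ 2 * ‖comb φ a (coef k s a e)‖ ^ 2
      + (gram k a *ᵥ coef k s a e) ⬝ᵥ (gram k a *ᵥ coef k s a e) := by
  rw [← real_inner_self_eq_norm_sq, inner_comb_comb hφ, gram_mulVec_coef hφ hs, selfNorm]
  simp only [dotProduct_sub, sub_dotProduct, dotProduct_smul, smul_dotProduct, smul_eq_mul]
  rw [dotProduct_comm _ e]
  ring

lemma selfNorm_nonneg (hφ : IsFeature k φ) (hs : 0 < s) (a : Fin n → X) (e : Fin n → ℝ) :
    0 ≤ selfNorm k s a e := by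
  rw [selfNorm_eq_sq hφ hs]
  exact add_nonneg (by positivity) (Finset.sum_nonneg fun i _ => mul_self_nonneg _)

/-- Spectrally this is `s² λ / (λ + s²) ≤ 1 · λ` on each eigenvalue; here Cauchy–Schwarz and AM–GM
replace diagonalisation. Together with `norm_comb_sq_le` it compares two regularisation levels. -/
lemma selfNorm_le (hφ : IsFeature k φ) (hs : 0 < s) (a : Fin n → X) (e : Fin n → ℝ) :
    s ^ 2 * selfNorm k s a e ≤ ‖comb φ a e‖ ^ 2 := by
  have h1 := selfNorm_eq_sq hφ hs a e
  have h2 : selfNorm k s a e ≤ ‖comb φ a e‖ * ‖comb φ a (coef k s a e)‖ := by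
    rw [selfNorm_eq hφ hs]
    exact real_inner_le_norm _ _
  have h3 : 0 ≤ (gram k a *ᵥ coef k s a e) ⬝ᵥ (gram k a *ᵥ coef k s a e) :=
    Finset.sum_nonneg fun i _ => mul_self_nonneg _
  nlinarith [sq_nonneg (‖comb φ a e‖ - s ^ 2 * ‖comb φ a (coef k s a e)‖), sq_nonneg s,
    mul_le_mul_of_nonneg_left h2 (sq_nonneg s)]

lemma comb_eq (hφ : IsFeature k φ) (hs : 0 < s) (a : Fin n → X) (e : Fin n → ℝ) :
    comb φ a e = s ^ 2 • comb φ a (coef k s a e) + comb φ a (gram k a *ᵥ coef k s a e) := by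
  rw [gram_mulVec_coef hφ hs]
  simp only [comb, Finset.smul_sum, ← Finset.sum_add_distrib]
  refine Finset.sum_congr rfl fun i _ => ?_
  rw [smul_smul, ← add_smul]
  simp

/-- Cauchy–Schwarz in `H ⊕ ℝⁿ` with weight `r` on `H`. -/
lemma inner_add_dotProduct_le {r : ℝ} (hr : 0 ≤ r) (u v : H) (p q : Fin n → ℝ) :
    (r * inner ℝ u v + p ⬝ᵥ q) ^ 2
      ≤ (r * ‖u‖ ^ 2 + p ⬝ᵥ p) * (r * ‖v‖ ^ 2 + q ⬝ᵥ q) := by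
  have h1 : |inner ℝ u v| ≤ ‖u‖ * ‖v‖ := abs_real_inner_le_norm u v
  have h2 : (p ⬝ᵥ q) ^ 2 ≤ (p ⬝ᵥ p) * (q ⬝ᵥ q) := by
    have := Finset.sum_mul_sq_le_sq_mul_sq Finset.univ p q
    simpa only [dotProduct, ← pow_two] using this
  have hp : 0 ≤ p ⬝ᵥ p := Finset.sum_nonneg fun i _ => mul_self_nonneg _
  have hq : 0 ≤ q ⬝ᵥ q := Finset.sum_nonneg fun i _ => mul_self_nonneg _
  obtain ⟨P, hP, hPp⟩ : ∃ P : ℝ, 0 ≤ P ∧ P ^ 2 = p ⬝ᵥ p := ⟨√_, by positivity, Real.sq_sqrt hp⟩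
  obtain ⟨Q, hQ, hQq⟩ : ∃ Q : ℝ, 0 ≤ Q ∧ Q ^ 2 = q ⬝ᵥ q := ⟨√_, by positivity, Real.sq_sqrt hq⟩
  rw [← hPp, ← hQq] at h2 ⊢
  have h3 : |p ⬝ᵥ q| ≤ P * Q := abs_le_of_sq_le_sq (by rw [mul_pow]; exact h2) (by positivity)
  have h4 : |r * inner ℝ u v + p ⬝ᵥ q| ≤ r * (‖u‖ * ‖v‖) + P * Q := by
    refine (abs_add_le _ _).trans (add_le_add ?_ h3)
    rw [abs_mul, abs_of_nonneg hr]
    gcongr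
  calc (r * inner ℝ u v + p ⬝ᵥ q) ^ 2 ≤ (r * (‖u‖ * ‖v‖) + P * Q) ^ 2 := by
        rw [← sq_abs]
        gcongr
    _ ≤ _ := by nlinarith [mul_nonneg hr (sq_nonneg (‖u‖ * Q - ‖v‖ * P))]

/-- Converse to `selfNorm_le`, at the cost of the trace. Pairing `S = ∑ eᵢ φ(aᵢ)` with itself
through `comb_eq` gives `‖S‖⁴ ≤ Z (s² ‖S‖² + ∑ ⟨φ(aᵢ), S⟩²)`; a factor `‖S‖²` then cancels. -/
lemma norm_comb_sq_le (hφ : IsFeature k φ) (hs : 0 < s) (a : Fin n → X) (e : Fin n → ℝ) :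
    ‖comb φ a e‖ ^ 2 ≤ selfNorm k s a e * (s ^ 2 + ∑ i, k (a i) (a i)) := by
  set S := comb φ a e with hS
  set w := coef k s a e with hw
  set q : Fin n → ℝ := fun i => inner ℝ (φ (a i)) S with hq
  have h1 : ‖S‖ ^ 2 = s ^ 2 * inner ℝ (comb φ a w) S + (gram k a *ᵥ w) ⬝ᵥ q := by
    rw [← real_inner_self_eq_norm_sq]
    nth_rw 1 [hS, comb_eq hφ hs a e]
    rw [inner_add_left, inner_smul_left]
    congr 1
    conv_lhs => rw [comb, sum_inner]
    simp [dotProduct, hq, inner_smul_left, hw]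
  have h2 := inner_add_dotProduct_le (sq_nonneg s) (comb φ a w) S (gram k a *ᵥ w) q
  rw [← h1, ← selfNorm_eq_sq hφ hs] at h2
  have h3 : q ⬝ᵥ q ≤ (∑ i, k (a i) (a i)) * ‖S‖ ^ 2 := by
    rw [dotProduct, Finset.sum_mul]
    refine Finset.sum_le_sum fun i _ => ?_
    rw [hφ, real_inner_self_eq_norm_sq, ← pow_two, ← mul_pow, ← sq_abs]
    gcongr
    exact abs_real_inner_le_norm _ _
  have h0 := selfNorm_nonneg hφ hs a e
  rcases (sq_nonneg ‖S‖).eq_or_lt with h | h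
  · rw [← h]
    refine mul_nonneg h0 (add_nonneg (sq_nonneg s) (Finset.sum_nonneg fun i _ => ?_))
    rw [hφ]
    exact real_inner_self_nonneg
  · refine le_of_mul_le_mul_right ?_ h
    calc ‖S‖ ^ 2 * ‖S‖ ^ 2 = (‖S‖ ^ 2) ^ 2 := by ring
      _ ≤ selfNorm k s a e * (s ^ 2 * ‖S‖ ^ 2 + q ⬝ᵥ q) := h2
      _ ≤ selfNorm k s a e * (s ^ 2 * ‖S‖ ^ 2 + (∑ i, k (a i) (a i)) * ‖S‖ ^ 2) := by gcongr
      _ = _ := by ring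

/-- The posterior variance is the minimum of the ridge objective for fitting `φ z` by the `φ(aᵢ)`:
squared residual plus penalty. -/
lemma postVar_eq (hφ : IsFeature k φ) (hs : 0 < s) (a : Fin n → X) (z : X) :
    postVar k s a z = ‖φ z - comb φ a (coef k s a (kvec k a z))‖ ^ 2
      + s ^ 2 * (coef k s a (kvec k a z) ⬝ᵥ coef k s a (kvec k a z)) := by
  set α := coef k s a (kvec k a z) with hα
  rw [norm_sub_sq_real, inner_feature_comb hφ, ← real_inner_self_eq_norm_sq,
    ← real_inner_self_eq_norm_sq (comb φ a α), inner_comb_comb hφ, hα, gram_mulVec_coef hφ hs,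
    ← hα, ← hφ, postVar]
  change _ - _ ⬝ᵥ α = _
  simp only [dotProduct_sub, dotProduct_smul, smul_eq_mul]
  rw [dotProduct_comm α (kvec k a z)]
  ring

lemma postVar_nonneg (hφ : IsFeature k φ) (hs : 0 < s) (a : Fin n → X) (z : X) :
    0 ≤ postVar k s a z := by
  rw [postVar_eq hφ hs]
  exact add_nonneg (sq_nonneg _)
    (mul_nonneg (sq_nonneg s) (Finset.sum_nonneg fun i _ => mul_self_nonneg _))

lemma postVar_le (hφ : IsFeature k φ) (hs : 0 < s) (a : Fin n → X) (z : X) :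
    postVar k s a z ≤ k z z := by
  have := (regGram_posDef hφ hs a).inv.posSemidef.dotProduct_mulVec_nonneg (kvec k a z)
  rw [postVar]
  simpa using this

/-- Deterministic confidence bound: the prediction error is at most
`(‖f‖ + s⁻¹ √(eᵀ K (K + s² I)⁻¹ e))` posterior standard deviations. -/
lemma abs_sub_postMean_le (hφ : IsFeature k φ) (hs : 0 < s) (a : Fin n → X) (e : Fin n → ℝ)
    (f : H) (z : X) :
    |inner ℝ f (φ z) - postMean k s a (fun i => inner ℝ f (φ (a i)) + e i) z|
      ≤ (‖f‖ + √(selfNorm k s a e) / s) * postStd k s a z := by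
  set α := coef k s a (kvec k a z) with hα
  set w := coef k s a e with hw
  set r := φ z - comb φ a α with hr
  have hmean : postMean k s a (fun i => inner ℝ f (φ (a i)) + e i) z
      = inner ℝ f (comb φ a α) + kvec k a z ⬝ᵥ w := by
    have h : (fun i => inner ℝ f (φ (a i)) + e i) = (fun i => inner ℝ f (φ (a i))) + e := rfl
    rw [h, postMean, Matrix.mulVec_add, dotProduct_add]
    congr 1
    change kvec k a z ⬝ᵥ coef k s a _ = _
    rw [dotProduct_coef_comm hφ, ← hα, comb, inner_sum]
    simp [dotProduct, inner_smul_right, mul_comm]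
  have hvar := postVar_eq hφ hs a z
  have hvar0 := postVar_nonneg hφ hs a z
  have hnoise : kvec k a z ⬝ᵥ w = inner ℝ r (comb φ a w) + α ⬝ᵥ (gram k a *ᵥ w) := by
    rw [hr, inner_sub_left, inner_feature_comb hφ, inner_comb_comb hφ]
    ring
  have hnorm : ‖r‖ ≤ postStd k s a z := by
    refine Real.le_sqrt_of_sq_le ?_
    rw [hvar, ← hα, ← hr]
    have : 0 ≤ α ⬝ᵥ α := Finset.sum_nonneg fun i _ => mul_self_nonneg _
    nlinarith [sq_nonneg s]
  have hcs : |kvec k a z ⬝ᵥ w| ≤ √(selfNorm k s a e) / s * postStd k s a z := by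
    -- The choice `s² • α` turns the first factor into `s²` times the posterior variance, by
    -- `postVar_eq`.
    have h := inner_add_dotProduct_le (sq_nonneg s) r (comb φ a w) (s ^ 2 • α) (gram k a *ᵥ w)
    rw [← selfNorm_eq_sq hφ hs, smul_dotProduct, smul_eq_mul, ← mul_add, ← hnoise,
      smul_dotProduct, dotProduct_smul, smul_eq_mul, smul_eq_mul, ← mul_add, ← hvar] at h
    refine Real.abs_le_sqrt (y := selfNorm k s a e / s ^ 2 * postVar k s a z) ?_ |>.trans ?_
    · rw [div_mul_eq_mul_div, le_div_iff₀ (by positivity)]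
      have h2 : 0 < s ^ 2 := by positivity
      nlinarith
    · rw [Real.sqrt_mul' _ hvar0, Real.sqrt_div' _ (sq_nonneg s), Real.sqrt_sq hs.le, postStd]
  have hf : |inner ℝ f r| ≤ ‖f‖ * postStd k s a z :=
    (abs_real_inner_le_norm f r).trans (by gcongr)
  have hsplit : inner ℝ f (φ z) - postMean k s a (fun i => inner ℝ f (φ (a i)) + e i) z
      = inner ℝ f r - kvec k a z ⬝ᵥ w := by
    rw [hmean, hr, inner_sub_right]
    ring
  rw [hsplit, add_mul]
  exact (abs_sub _ _).trans (add_le_add hf hcs)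

end LinearAlgebra

end GPUCB

namespace GPUCB

/-! ### Rank-one updates and the information gain. -/

section Recursion

variable {X H : Type*} [NormedAddCommGroup H] [InnerProductSpace ℝ H]
  {k : X → X → ℝ} {φ : X → H} {s : ℝ} {n : ℕ}

/-- Appending a point to a tuple. -/
abbrev append {Y : Type*} (a : Fin n → Y) (z : Y) : Fin (n + 1) → Y :=
  Fin.snoc (α := fun _ => Y) a z

lemma regGram_castSucc (a : Fin n → X) (z : X) (i j : Fin n) :
    regGram k s (append a z) i.castSucc j.castSucc = regGram k s a i j := by
  simp [regGram, gram, Matrix.one_apply]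

lemma regGram_castSucc_last (a : Fin n → X) (z : X) (i : Fin n) :
    regGram k s (append a z) i.castSucc (Fin.last n) = kvec k a z i := by
  simp [regGram, gram, kvec, (Fin.castSucc_lt_last i).ne]

lemma regGram_last_castSucc (hφ : IsFeature k φ) (a : Fin n → X) (z : X) (i : Fin n) :
    regGram k s (append a z) (Fin.last n) i.castSucc = kvec k a z i := by
  have : k z (a i) = k (a i) z := by rw [hφ, hφ, real_inner_comm]
  simp [regGram, gram, kvec, (Fin.castSucc_lt_last i).ne', this]

lemma regGram_last_last (a : Fin n → X) (z : X) :
    regGram k s (append a z) (Fin.last n) (Fin.last n) = k z z + s ^ 2 := by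
  simp [regGram, gram]

lemma postVar_eq_coef (a : Fin n → X) (z : X) :
    postVar k s a z = k z z - kvec k a z ⬝ᵥ coef k s a (kvec k a z) := rfl

lemma postMean_eq_coef (a : Fin n → X) (y : Fin n → ℝ) (z : X) :
    postMean k s a y z = kvec k a z ⬝ᵥ coef k s a y := rfl

/-- Block elimination: `s² + postVar` is the Schur complement of the old block, and the new
coefficient is the innovation divided by it. Uniqueness of the solution reduces the claim to
multiplying out. -/
lemma coef_append (hφ : IsFeature k φ) (hs : 0 < s) (a : Fin n → X) (z : X) (e : Fin n → ℝ)
    (η : ℝ) :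
    coef k s (append a z) (append e η)
      = append (coef k s a e
          - ((η - postMean k s a e z) / (s ^ 2 + postVar k s a z)) • coef k s a (kvec k a z))
        ((η - postMean k s a e z) / (s ^ 2 + postVar k s a z)) := by
  set c := (η - postMean k s a e z) / (s ^ 2 + postVar k s a z) with hc
  have hpos : 0 < s ^ 2 + postVar k s a z :=
    add_pos_of_pos_of_nonneg (pow_pos hs 2) (postVar_nonneg hφ hs a z)
  have hcm : c * (s ^ 2 + postVar k s a z) = η - postMean k s a e z := div_mul_cancel₀ _ hpos.ne'
  refine coef_eq_of_mulVec hφ hs _ (funext fun i => ?_)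
  refine Fin.lastCases ?_ (fun i => ?_) i
  · rw [Matrix.mulVec, dotProduct, Fin.sum_univ_castSucc]
    simp only [regGram_last_castSucc hφ, regGram_last_last, Fin.snoc_castSucc, Fin.snoc_last]
    change kvec k a z ⬝ᵥ (coef k s a e - c • coef k s a (kvec k a z)) + _ = η
    rw [dotProduct_sub, dotProduct_smul, smul_eq_mul, ← postMean_eq_coef]
    rw [postVar_eq_coef] at hcm
    linarith
  · rw [Matrix.mulVec, dotProduct, Fin.sum_univ_castSucc]
    simp only [regGram_castSucc, regGram_castSucc_last, Fin.snoc_castSucc, Fin.snoc_last]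
    change (regGram k s a *ᵥ (coef k s a e - c • coef k s a (kvec k a z))) i + _ = e i
    rw [Matrix.mulVec_sub, Matrix.mulVec_smul, regGram_mulVec_coef hφ hs,
      regGram_mulVec_coef hφ hs]
    simp only [Pi.sub_apply, Pi.smul_apply, smul_eq_mul]
    ring

lemma dotProduct_append (u v : Fin n → ℝ) (p q : ℝ) :
    append u p ⬝ᵥ append v q = u ⬝ᵥ v + p * q := by
  simp [dotProduct, Fin.sum_univ_castSucc]

/-- The increment is exactly the exponent of the Gaussian mixture in
`lintegral_exp_mul_gaussianPDF`, with `m` the ridge prediction of the noise and `v = postVar / s²`.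
-/
lemma selfNorm_append (hφ : IsFeature k φ) (hs : 0 < s) (a : Fin n → X) (z : X) (e : Fin n → ℝ)
    (η : ℝ) :
    selfNorm k s (append a z) (append e η)
      = selfNorm k s a e
        + (η ^ 2 - (η - postMean k s a e z) ^ 2 / (1 + postVar k s a z / s ^ 2)) := by
  have hpos : 0 < s ^ 2 + postVar k s a z :=
    add_pos_of_pos_of_nonneg (pow_pos hs 2) (postVar_nonneg hφ hs a z)
  have hs2 : s ^ 2 ≠ 0 := (pow_pos hs 2).ne'
  have hm : e ⬝ᵥ coef k s a (kvec k a z) = postMean k s a e z := dotProduct_coef_comm hφ a _ _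
  rw [selfNorm, coef_append hφ hs, dotProduct_append, dotProduct_append, dotProduct_sub,
    dotProduct_smul, hm, selfNorm, smul_eq_mul]
  have : 1 + postVar k s a z / s ^ 2 = (s ^ 2 + postVar k s a z) / s ^ 2 := by field_simp
  rw [this]
  field_simp
  ring

lemma gainDet_eq (hs : 0 < s) (a : Fin n → X) :
    gainDet k s a = (s ^ 2)⁻¹ ^ n * (regGram k s a).det := by
  have : (1 + (s ^ 2)⁻¹ • gram k a : Matrix (Fin n) (Fin n) ℝ) = (s ^ 2)⁻¹ • regGram k s a := by
    rw [regGram, smul_add, smul_smul, inv_mul_cancel₀ (pow_pos hs 2).ne', one_smul, add_comm]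
  rw [gainDet, this, Matrix.det_smul, Fintype.card_fin]

lemma det_regGram_append (hφ : IsFeature k φ) (hs : 0 < s) (a : Fin n → X) (z : X) :
    (regGram k s (append a z)).det = (regGram k s a).det * (s ^ 2 + postVar k s a z) := by
  have hblock : (regGram k s (append a z)).submatrix (finSumFinEquiv (m := n) (n := 1))
        (finSumFinEquiv (m := n) (n := 1))
      = Matrix.fromBlocks (regGram k s a) (Matrix.of fun i _ => kvec k a z i)
          (Matrix.of fun _ i => kvec k a z i) (Matrix.of fun _ _ => k z z + s ^ 2) := by
    ext i j
    rcases i with i | i <;> rcases j with j | j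
    · exact regGram_castSucc a z i j
    · obtain rfl : j = 0 := Subsingleton.elim _ _
      exact regGram_castSucc_last a z i
    · obtain rfl : i = 0 := Subsingleton.elim _ _
      exact regGram_last_castSucc hφ a z j
    · obtain rfl : j = 0 := Subsingleton.elim _ _
      obtain rfl : i = 0 := Subsingleton.elim _ _
      exact regGram_last_last a z
  let _ := (regGram k s a).invertibleOfIsUnitDet (regGram_isUnit hφ hs a)
  rw [← Matrix.det_submatrix_equiv_self (finSumFinEquiv (m := n) (n := 1)), hblock,
    Matrix.det_fromBlocks₁₁]
  congr 1
  rw [Matrix.det_unique, Matrix.invOf_eq_nonsing_inv, postVar, Matrix.mul_assoc]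
  simp only [Matrix.sub_apply, Matrix.of_apply]
  have : ((Matrix.of fun (_ : Fin 1) i => kvec k a z i) *
      ((regGram k s a)⁻¹ * Matrix.of fun i (_ : Fin 1) => kvec k a z i)) default default
      = kvec k a z ⬝ᵥ ((regGram k s a)⁻¹ *ᵥ kvec k a z) := rfl
  rw [this]
  ring

lemma gainDet_append (hφ : IsFeature k φ) (hs : 0 < s) (a : Fin n → X) (z : X) :
    gainDet k s (append a z) = gainDet k s a * (1 + postVar k s a z / s ^ 2) := by
  have hs2 : s ^ 2 ≠ 0 := (pow_pos hs 2).ne'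
  rw [gainDet_eq hs, gainDet_eq hs, det_regGram_append hφ hs, pow_succ]
  field_simp

lemma gainDet_zero (a : Fin 0 → X) : gainDet k s a = 1 := by simp [gainDet]

lemma append_init {Y : Type*} (a : Fin (n + 1) → Y) :
    append (fun i => a i.castSucc) (a (Fin.last n)) = a :=
  Fin.snoc_init_self (α := fun _ => Y) a

lemma one_le_gainDet (hφ : IsFeature k φ) (hs : 0 < s) (a : Fin n → X) : 1 ≤ gainDet k s a := by
  induction n with
  | zero => rw [gainDet_zero]
  | succ n ih =>
    rw [← append_init a, gainDet_append hφ hs]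
    exact one_le_mul_of_one_le_of_one_le (ih _)
      (le_add_of_nonneg_right (div_nonneg (postVar_nonneg hφ hs _ _) (sq_nonneg s)))

/-- Apply `log (1 + u) ≤ u` to each factor of the recursion and bound the posterior variance by the
prior one. -/
lemma log_gainDet_le (hφ : IsFeature k φ) (hs : 0 < s) (a : Fin n → X) :
    Real.log (gainDet k s a) ≤ (∑ i, k (a i) (a i)) / s ^ 2 := by
  induction n with
  | zero => simp [gainDet_zero]
  | succ n ih =>
    have h0 := div_nonneg (postVar_nonneg hφ hs (fun i => a i.castSucc) (a (Fin.last n)))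
      (sq_nonneg s)
    rw [Fin.sum_univ_castSucc, add_div]
    nth_rw 1 [← append_init a]
    rw [gainDet_append hφ hs,
      Real.log_mul (by linarith [one_le_gainDet hφ hs (fun i => a i.castSucc)]) (by linarith)]
    refine add_le_add (ih _) ?_
    have h1 := Real.log_le_sub_one_of_pos (x := 1 + postVar k s (fun i => a i.castSucc)
      (a (Fin.last n)) / s ^ 2) (by linarith)
    have h2 : postVar k s (fun i => a i.castSucc) (a (Fin.last n)) / s ^ 2
        ≤ k (a (Fin.last n)) (a (Fin.last n)) / s ^ 2 := by
      gcongr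
      exact postVar_le hφ hs _ _
    linarith

lemma gainDet_const (z : X) : gainDet k s (fun _ : Fin n => z) = 1 + n * k z z / s ^ 2 := by
  have : (s ^ 2)⁻¹ • gram k (fun _ : Fin n => z)
      = Matrix.replicateCol Unit (fun _ : Fin n => (s ^ 2)⁻¹ * k z z)
        * Matrix.replicateRow Unit (fun _ : Fin n => (1 : ℝ)) := by
    ext i j
    simp [gram, Matrix.mul_apply]
  rw [gainDet, this, Matrix.det_one_add_replicateCol_mul_replicateRow]
  simp [dotProduct]
  ring

section InfoGain

variable (hφ : IsFeature k φ) (hk1 : ∀ z z', k z z' ≤ 1)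
include hφ hk1

lemma bddAbove_gain (hs : 0 < s) (n : ℕ) :
    BddAbove (Set.range fun a : Fin n → X => (1 / 2) * Real.log (gainDet k s a)) := by
  refine ⟨(1 / 2) * (n / s ^ 2), ?_⟩
  rintro _ ⟨a, rfl⟩
  have h1 := log_gainDet_le hφ hs a
  have h2 : (∑ i, k (a i) (a i)) / s ^ 2 ≤ n / s ^ 2 := by
    gcongr
    simpa using Finset.sum_le_sum fun i (_ : i ∈ Finset.univ) => hk1 (a i) (a i)
  dsimp only
  linarith

lemma half_log_gainDet_le_infoGain (hs : 0 < s) (a : Fin n → X) :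
    (1 / 2) * Real.log (gainDet k s a) ≤ infoGain k s n :=
  le_ciSup (bddAbove_gain hφ hk1 hs n) a

/-- Round `n + 1` sees only `n` observations while its scale uses `γ_{n+1}`; an extra point can only
increase the determinant. -/
lemma half_log_gainDet_le_infoGain_succ (hs : 0 < s) (a : Fin n → X) (z : X) :
    (1 / 2) * Real.log (gainDet k s a) ≤ infoGain k s (n + 1) := by
  refine le_trans ?_ (half_log_gainDet_le_infoGain hφ hk1 hs (append a z))
  have h0 := one_le_gainDet hφ hs a
  have h1 := div_nonneg (postVar_nonneg hφ hs a z) (sq_nonneg s)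
  gcongr
  rw [gainDet_append hφ hs]
  exact le_mul_of_one_le_right (by linarith) (by linarith)

lemma infoGain_nonneg (hs : 0 < s) [Nonempty X] (n : ℕ) : 0 ≤ infoGain k s n := by
  obtain ⟨z⟩ := ‹Nonempty X›
  refine le_trans ?_ (half_log_gainDet_le_infoGain hφ hk1 hs (fun _ : Fin n => z))
  have := Real.log_nonneg (one_le_gainDet hφ hs (fun _ : Fin n => z))
  positivity

/-- A small information gain forces a small Gram trace. -/
lemma sum_diag_le_of_infoGain_le (hs : 0 < s) (a : Fin n → X) (hγ : infoGain k s (n + 1) ≤ 1 / 16) :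
    ∑ i, k (a i) (a i) ≤ 3 * infoGain k s (n + 1) * s ^ 2 := by
  set γ := infoGain k s (n + 1) with hγd
  have hs2 : 0 < s ^ 2 := pow_pos hs 2
  have hpt : ∀ z : X, (n + 1 : ℝ) * (k z z) ≤ 3 * γ * s ^ 2 := by
    intro z
    -- Repeating one point `n + 1` times is an admissible design, so `γ` controls `k z z` for each
    -- `z` separately.
    have h := half_log_gainDet_le_infoGain hφ hk1 hs (fun _ : Fin (n + 1) => z)
    rw [gainDet_const] at h
    have hk0 : 0 ≤ k z z := by
      rw [hφ]
      exact real_inner_self_nonneg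
    set u : ℝ := ((n + 1 : ℕ) : ℝ) * k z z / s ^ 2 with hu
    have hu0 : 0 ≤ u := by positivity
    have h1 := Real.one_sub_inv_le_log_of_pos (x := 1 + u) (by linarith)
    have h2 : 1 - (1 + u)⁻¹ ≤ 2 * γ := by linarith
    have h3 : u ≤ 2 * γ * (1 + u) := by
      have : u = (1 - (1 + u)⁻¹) * (1 + u) := by
        field_simp
        ring
      refine this.trans_le ?_
      exact mul_le_mul_of_nonneg_right h2 (by linarith)
    -- As `2γ ≤ 1/8`, one gets `u ≤ 2γ / (1 - 2γ) ≤ 16γ/7`.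
    have h4 : u ≤ 3 * γ := by nlinarith
    rw [hu, div_le_iff₀ hs2] at h4
    push_cast at h4
    exact h4
  rcases Nat.eq_zero_or_pos n with rfl | hn
  · rcases isEmpty_or_nonempty X with hX | hX
    · have : γ = 0 := by
        rw [hγd, infoGain]
        exact Real.iSup_of_isEmpty _
      simp [this]
    · have := infoGain_nonneg hφ hk1 hs 1
      simp only [Finset.univ_eq_empty, Finset.sum_empty]
      positivity
  · have hn' : (0 : ℝ) < n := by exact_mod_cast hn
    have h5 : ∑ i, (n + 1 : ℝ) * k (a i) (a i) ≤ n * (3 * γ * s ^ 2) := by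
      simpa using Finset.sum_le_sum fun i (_ : i ∈ Finset.univ) => hpt (a i)
    rw [← Finset.mul_sum] at h5
    have h6 : 0 ≤ ∑ i, k (a i) (a i) := Finset.sum_nonneg fun i _ => by
      rw [hφ]
      exact real_inner_self_nonneg
    nlinarith

end InfoGain

end Recursion

end GPUCB

namespace GPUCB

/-! ### Sub-Gaussian likelihood ratios with predictable tilt, and their Gaussian mixtures. -/

section SubGaussian

open scoped ENNReal

lemma exists_finite_range_tendsto {Ω : Type*} {m : MeasurableSpace Ω} {h : Ω → ℝ}
    (hh : Measurable h) :
    ∃ hn : ℕ → Ω → ℝ, (∀ n, Measurable (hn n)) ∧ (∀ n, (Set.range (hn n)).Finite) ∧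
      ∀ ω, Filter.Tendsto (fun n => hn n ω) Filter.atTop (nhds (h ω)) :=
  ⟨(hh.stronglyMeasurable.approx ·), fun _ => SimpleFunc.measurable _,
    fun _ => SimpleFunc.finite_range _, hh.stronglyMeasurable.tendsto_approx⟩

variable {Ω : Type*} {G mΩ : MeasurableSpace Ω} {P : Measure Ω} [IsProbabilityMeasure P]
  {ξ : Ω → ℝ} {σ : ℝ}

/-- The conditional bound says that tilting `P` by the likelihood ratio does not increase the
measure of any `G`-set; integrating the `G`-measurable `A` against the trimmed measures gives the
claim without integrability of `A`. -/
lemma lintegral_mul_exp_const_le (hG : G ≤ mΩ) (hξ : Measurable ξ) {c : ℝ}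
    (hint : Integrable (fun ω => Real.exp (c * ξ ω)) P)
    (hsg : P[fun ω => Real.exp (c * ξ ω) | G] ≤ᵐ[P] fun _ => Real.exp (c ^ 2 * σ ^ 2 / 2))
    {A : Ω → ℝ≥0∞} (hA : Measurable[G] A) :
    ∫⁻ ω, A ω * ENNReal.ofReal (Real.exp (c * ξ ω - c ^ 2 * σ ^ 2 / 2)) ∂P ≤ ∫⁻ ω, A ω ∂P := by
  set F : Ω → ℝ≥0∞ := fun ω => ENNReal.ofReal (Real.exp (c * ξ ω - c ^ 2 * σ ^ 2 / 2)) with hF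
  have hFm : Measurable F := by fun_prop
  have hle : (P.withDensity F).trim hG ≤ P.trim hG := by
    refine Measure.le_iff.2 fun s hs => ?_
    have hs' : MeasurableSet s := hG s hs
    rw [trim_measurableSet_eq hG hs, trim_measurableSet_eq hG hs, withDensity_apply _ hs']
    have h1 : ∫ ω in s, Real.exp (c * ξ ω) ∂P ≤ P.real s * Real.exp (c ^ 2 * σ ^ 2 / 2) := by
      rw [← setIntegral_condExp hG hint hs]
      refine (setIntegral_mono_ae integrable_condExp.integrableOn
        (integrable_const _).integrableOn hsg).trans_eq ?_
      simp
    have h2 : ∀ ω, Real.exp (c * ξ ω - c ^ 2 * σ ^ 2 / 2)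
        = Real.exp (c * ξ ω) * (Real.exp (c ^ 2 * σ ^ 2 / 2))⁻¹ := fun ω => by
      rw [Real.exp_sub, div_eq_mul_inv]
    simp only [hF, h2]
    rw [← ofReal_integral_eq_lintegral_ofReal (hint.integrableOn.mul_const _)
      (Filter.Eventually.of_forall fun ω => by positivity), integral_mul_const,
      ← ofReal_measureReal]
    refine ENNReal.ofReal_le_ofReal ?_
    rw [← div_eq_mul_inv, div_le_iff₀ (Real.exp_pos _)]
    exact h1
  calc ∫⁻ ω, A ω * F ω ∂P = ∫⁻ ω, A ω ∂(P.withDensity F) := by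
        rw [lintegral_withDensity_eq_lintegral_mul _ hFm (hA.mono hG le_rfl)]
        exact lintegral_congr fun ω => mul_comm _ _
    _ = ∫⁻ ω, A ω ∂((P.withDensity F).trim hG) := (lintegral_trim hG hA).symm
    _ ≤ ∫⁻ ω, A ω ∂(P.trim hG) := lintegral_mono' hle le_rfl
    _ = ∫⁻ ω, A ω ∂P := lintegral_trim hG hA

variable (hG : G ≤ mΩ) (hξ : Measurable ξ)
  (hsg : ∀ c : ℝ, Integrable (fun ω => Real.exp (c * ξ ω)) P ∧
    P[fun ω => Real.exp (c * ξ ω) | G] ≤ᵐ[P] fun _ => Real.exp (c ^ 2 * σ ^ 2 / 2))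
include hG hξ hsg

/-- On each level set of `h` the tilt is constant, and the indicator of that set can be absorbed
into `A`. -/
lemma lintegral_mul_exp_finite_range_le {A : Ω → ℝ≥0∞} (hA : Measurable[G] A) {h : Ω → ℝ}
    (hh : Measurable[G] h) (hfin : (Set.range h).Finite) :
    ∫⁻ ω, A ω * ENNReal.ofReal (Real.exp (h ω * ξ ω - h ω ^ 2 * σ ^ 2 / 2)) ∂P
      ≤ ∫⁻ ω, A ω ∂P := by
  have hset : ∀ r, MeasurableSet[G] (h ⁻¹' {r}) := fun r => hh (measurableSet_singleton r)
  have hdecomp : ∀ (q : Ω → ℝ≥0∞) (ω : Ω),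
      q ω = ∑ r ∈ hfin.toFinset, (h ⁻¹' {r}).indicator q ω := by
    intro q ω
    rw [Finset.sum_eq_single (h ω)]
    · rw [Set.indicator_of_mem]
      rfl
    · intro r _ hr
      rw [Set.indicator_of_notMem]
      intro hω
      exact hr (Set.mem_singleton_iff.1 hω).symm
    · intro hω
      exact absurd (hfin.mem_toFinset.2 (Set.mem_range_self ω)) hω
  have hAm : ∀ r, Measurable[G] ((h ⁻¹' {r}).indicator A) := fun r => hA.indicator (hset r)
  calc ∫⁻ ω, A ω * ENNReal.ofReal (Real.exp (h ω * ξ ω - h ω ^ 2 * σ ^ 2 / 2)) ∂P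
      = ∫⁻ ω, ∑ r ∈ hfin.toFinset, (h ⁻¹' {r}).indicator A ω
          * ENNReal.ofReal (Real.exp (r * ξ ω - r ^ 2 * σ ^ 2 / 2)) ∂P := by
        refine lintegral_congr fun ω => ?_
        rw [hdecomp (fun ω => A ω * ENNReal.ofReal
          (Real.exp (h ω * ξ ω - h ω ^ 2 * σ ^ 2 / 2))) ω]
        refine Finset.sum_congr rfl fun r _ => ?_
        by_cases hω : ω ∈ h ⁻¹' {r}
        · have : h ω = r := hω
          rw [Set.indicator_of_mem hω, Set.indicator_of_mem hω, this]
        · rw [Set.indicator_of_notMem hω, Set.indicator_of_notMem hω, zero_mul]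
    _ = ∑ r ∈ hfin.toFinset, ∫⁻ ω, (h ⁻¹' {r}).indicator A ω
          * ENNReal.ofReal (Real.exp (r * ξ ω - r ^ 2 * σ ^ 2 / 2)) ∂P := by
        refine lintegral_finsetSum _ fun r _ => ?_
        exact ((hAm r).mono hG le_rfl).mul (by fun_prop)
    _ ≤ ∑ r ∈ hfin.toFinset, ∫⁻ ω, (h ⁻¹' {r}).indicator A ω ∂P :=
        Finset.sum_le_sum fun r _ =>
          lintegral_mul_exp_const_le hG hξ (hsg r).1 (hsg r).2 (hAm r)
    _ = ∫⁻ ω, ∑ r ∈ hfin.toFinset, (h ⁻¹' {r}).indicator A ω ∂P :=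
        (lintegral_finsetSum _ fun r _ => (hAm r).mono hG le_rfl).symm
    _ = ∫⁻ ω, A ω ∂P := lintegral_congr fun ω => (hdecomp A ω).symm

/-- Approximate `h` by functions of finite range and use Fatou's lemma. -/
lemma lintegral_mul_exp_le {A : Ω → ℝ≥0∞} (hA : Measurable[G] A) {h : Ω → ℝ}
    (hh : Measurable[G] h) :
    ∫⁻ ω, A ω * ENNReal.ofReal (Real.exp (h ω * ξ ω - h ω ^ 2 * σ ^ 2 / 2)) ∂P
      ≤ ∫⁻ ω, A ω ∂P := by
  obtain ⟨hn, hnm, hnf, hlim⟩ := exists_finite_range_tendsto hh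
  have hmeas : ∀ n, Measurable (fun ω =>
      A ω * ENNReal.ofReal (Real.exp (hn n ω * ξ ω - hn n ω ^ 2 * σ ^ 2 / 2))) := by
    intro n
    have h1 : Measurable (hn n) := (hnm n).mono hG le_rfl
    have h2 : Measurable A := hA.mono hG le_rfl
    fun_prop
  have hcont : ∀ ω, Filter.liminf (fun n =>
      A ω * ENNReal.ofReal (Real.exp (hn n ω * ξ ω - hn n ω ^ 2 * σ ^ 2 / 2))) Filter.atTop
      = A ω * ENNReal.ofReal (Real.exp (h ω * ξ ω - h ω ^ 2 * σ ^ 2 / 2)) := by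
    intro ω
    refine Filter.Tendsto.liminf_eq ?_
    refine ENNReal.Tendsto.const_mul ?_ (Or.inl ?_)
    · have hc : Continuous fun t : ℝ =>
          ENNReal.ofReal (Real.exp (t * ξ ω - t ^ 2 * σ ^ 2 / 2)) :=
        ENNReal.continuous_ofReal.comp (by fun_prop)
      exact (hc.tendsto (h ω)).comp (hlim ω)
    · exact (ENNReal.ofReal_pos.2 (Real.exp_pos _)).ne'
  calc ∫⁻ ω, A ω * ENNReal.ofReal (Real.exp (h ω * ξ ω - h ω ^ 2 * σ ^ 2 / 2)) ∂P
      = ∫⁻ ω, Filter.liminf (fun n => A ω * ENNReal.ofReal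
          (Real.exp (hn n ω * ξ ω - hn n ω ^ 2 * σ ^ 2 / 2))) Filter.atTop ∂P :=
        lintegral_congr fun ω => (hcont ω).symm
    _ ≤ Filter.liminf (fun n => ∫⁻ ω, A ω * ENNReal.ofReal
          (Real.exp (hn n ω * ξ ω - hn n ω ^ 2 * σ ^ 2 / 2)) ∂P) Filter.atTop :=
        lintegral_liminf_le hmeas
    _ ≤ Filter.liminf (fun _ : ℕ => ∫⁻ ω, A ω ∂P) Filter.atTop :=
        Filter.liminf_le_liminf (Filter.Eventually.of_forall fun n =>
          lintegral_mul_exp_finite_range_le hG hξ hsg hA (hnm n) (hnf n))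
    _ = ∫⁻ ω, A ω ∂P := Filter.liminf_const _

omit hG hξ hsg in
/-- Gaussian mixture of exponential likelihood ratios. -/
lemma lintegral_exp_mul_gaussianPDF (hσ : 0 < σ) (x m v : ℝ) (hv : 0 ≤ v) :
    ∫⁻ g, ENNReal.ofReal (Real.exp ((m + σ * √v * g) / σ ^ 2 * x
        - ((m + σ * √v * g) / σ ^ 2) ^ 2 * σ ^ 2 / 2)) * gaussianPDF 0 1 g
      = ENNReal.ofReal (Real.exp ((x ^ 2 - (x - m) ^ 2 / (1 + v)) / (2 * σ ^ 2)) / √(1 + v)) := by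
  have h1v : 0 < 1 + v := by linarith
  let τ : NNReal := ⟨(1 + v)⁻¹, by positivity⟩
  have hτ : (τ : ℝ) = (1 + v)⁻¹ := rfl
  have hτ0 : τ ≠ 0 := by
    intro h
    have := congrArg NNReal.toReal h
    rw [hτ] at this
    simp at this
    linarith
  set b := √v * (x - m) / σ with hb
  have hpt : ∀ g, Real.exp ((m + σ * √v * g) / σ ^ 2 * x
        - ((m + σ * √v * g) / σ ^ 2) ^ 2 * σ ^ 2 / 2) * gaussianPDFReal 0 1 g
      = (Real.exp ((x ^ 2 - (x - m) ^ 2 / (1 + v)) / (2 * σ ^ 2)) / √(1 + v))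
        * gaussianPDFReal (b / (1 + v)) τ g := by
    intro g
    have hsq : √(2 * Real.pi * (1 + v)⁻¹) = √(2 * Real.pi) / √(1 + v) := by
      rw [Real.sqrt_mul (by positivity), Real.sqrt_inv, div_eq_mul_inv]
    -- Completing the square in `g`: the product is an unnormalised Gaussian density of variance `(1
    -- + v)⁻¹`.
    have hexp : (m + σ * √v * g) / σ ^ 2 * x - ((m + σ * √v * g) / σ ^ 2) ^ 2 * σ ^ 2 / 2
          + -(g - 0) ^ 2 / (2 * 1)
        = (x ^ 2 - (x - m) ^ 2 / (1 + v)) / (2 * σ ^ 2)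
          + -(g - b / (1 + v)) ^ 2 / (2 * (1 + v)⁻¹) := by
      rw [hb]
      obtain ⟨r, hr⟩ : ∃ r, r = √v := ⟨_, rfl⟩
      have hv2 : v = r ^ 2 := by rw [hr, Real.sq_sqrt hv]
      rw [← hr]
      rw [hv2] at h1v ⊢
      field_simp
      ring
    rw [gaussianPDFReal, gaussianPDFReal, hτ, hsq]
    simp only [NNReal.coe_one, mul_one]
    rw [mul_one] at hexp
    have hE := congrArg Real.exp hexp
    rw [Real.exp_add, Real.exp_add] at hE
    have h2 : √(1 + v) ≠ 0 := (Real.sqrt_pos.2 h1v).ne'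
    have h3 : √(2 * Real.pi) ≠ 0 := (Real.sqrt_pos.2 (by positivity)).ne'
    have h4 : ∀ p q r t : ℝ, p * q = r * t → p * ((√(2 * Real.pi))⁻¹ * q)
        = r / √(1 + v) * ((√(2 * Real.pi) / √(1 + v))⁻¹ * t) := by
      intro p q r t h
      field_simp
      exact h
    exact h4 _ _ _ _ hE
  have hpt' : ∀ g, ENNReal.ofReal (Real.exp ((m + σ * √v * g) / σ ^ 2 * x
        - ((m + σ * √v * g) / σ ^ 2) ^ 2 * σ ^ 2 / 2)) * gaussianPDF 0 1 g
      = ENNReal.ofReal (Real.exp ((x ^ 2 - (x - m) ^ 2 / (1 + v)) / (2 * σ ^ 2)) / √(1 + v))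
        * gaussianPDF (b / (1 + v)) τ g := by
    intro g
    rw [gaussianPDF, gaussianPDF, ← ENNReal.ofReal_mul (Real.exp_pos _).le, hpt,
      ENNReal.ofReal_mul (by positivity)]
  rw [lintegral_congr hpt', lintegral_const_mul _ (measurable_gaussianPDF _ _),
    lintegral_gaussianPDF_eq_one _ hτ0, mul_one]

/-- For fixed `g` the tilt `(m + σ √v g) / σ²` is `G`-measurable, so `lintegral_mul_exp_le` applies;
Tonelli then averages over `g`. -/
lemma lintegral_mul_mixture_le (hσ : 0 < σ) {A : Ω → ℝ≥0∞} (hA : Measurable[G] A) {m v : Ω → ℝ}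
    (hm : Measurable[G] m) (hv : Measurable[G] v) (hv0 : ∀ ω, 0 ≤ v ω) :
    ∫⁻ ω, A ω * ENNReal.ofReal (Real.exp ((ξ ω ^ 2 - (ξ ω - m ω) ^ 2 / (1 + v ω)) / (2 * σ ^ 2))
      / √(1 + v ω)) ∂P ≤ ∫⁻ ω, A ω ∂P := by
  have hAm : Measurable A := hA.mono hG le_rfl
  have hmm : Measurable m := hm.mono hG le_rfl
  have hvm : Measurable v := hv.mono hG le_rfl
  have hpdf : Measurable (gaussianPDF 0 1) := measurable_gaussianPDF 0 1
  calc ∫⁻ ω, A ω * ENNReal.ofReal (Real.exp ((ξ ω ^ 2 - (ξ ω - m ω) ^ 2 / (1 + v ω))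
          / (2 * σ ^ 2)) / √(1 + v ω)) ∂P
      = ∫⁻ ω, (∫⁻ g, A ω * ENNReal.ofReal (Real.exp ((m ω + σ * √(v ω) * g) / σ ^ 2 * ξ ω
          - ((m ω + σ * √(v ω) * g) / σ ^ 2) ^ 2 * σ ^ 2 / 2)) * gaussianPDF 0 1 g) ∂P := by
        refine lintegral_congr fun ω => ?_
        rw [← lintegral_exp_mul_gaussianPDF hσ _ _ _ (hv0 ω), ← lintegral_const_mul]
        · exact lintegral_congr fun g => (mul_assoc _ _ _).symm
        · fun_prop
    _ = ∫⁻ g, ∫⁻ ω, A ω * ENNReal.ofReal (Real.exp ((m ω + σ * √(v ω) * g) / σ ^ 2 * ξ ω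
          - ((m ω + σ * √(v ω) * g) / σ ^ 2) ^ 2 * σ ^ 2 / 2)) * gaussianPDF 0 1 g ∂P := by
        refine lintegral_lintegral_swap (Measurable.aemeasurable ?_)
        simp only [Function.uncurry_def]
        fun_prop
    _ ≤ ∫⁻ g, (∫⁻ ω, A ω ∂P) * gaussianPDF 0 1 g := by
        refine lintegral_mono fun g => ?_
        rw [lintegral_mul_const]
        · refine mul_le_mul_left ?_ _
          refine lintegral_mul_exp_le hG hξ hsg hA ?_
          exact ((hm.add ((hv.sqrt.const_mul σ).mul_const g)).div_const _)
        · fun_prop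
    _ = ∫⁻ ω, A ω ∂P := by
        rw [lintegral_const_mul _ hpdf, lintegral_gaussianPDF_eq_one _ one_ne_zero, mul_one]

end SubGaussian

end GPUCB

namespace GPUCB

/-! ### Measurability of the regression quantities. -/

section Measurability

variable {Ω X : Type*} {m : MeasurableSpace Ω} {n : ℕ}

lemma measurable_det {M : Ω → Matrix (Fin n) (Fin n) ℝ}
    (hM : ∀ i j, Measurable fun ω => M ω i j) : Measurable fun ω => (M ω).det := by
  simp only [Matrix.det_apply']
  exact Finset.measurable_fun_sum _ fun τ _ =>
    (Finset.measurable_fun_prod _ fun i _ => hM (τ i) i).const_mul _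

lemma measurable_inv_apply {M : Ω → Matrix (Fin n) (Fin n) ℝ}
    (hM : ∀ i j, Measurable fun ω => M ω i j) (i j : Fin n) :
    Measurable fun ω => (M ω)⁻¹ i j := by
  simp only [Matrix.inv_def, Ring.inverse_eq_inv', Matrix.smul_apply, smul_eq_mul,
    Matrix.adjugate_apply]
  refine (measurable_det hM).inv.mul (measurable_det fun p q => ?_)
  by_cases hp : p = j
  · subst hp
    simp
  · simpa [Matrix.updateRow_ne hp] using hM p q

variable [MeasurableSpace X] {k : X → X → ℝ} {s : ℝ} {a : Ω → Fin n → X}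

lemma measurable_regGram_apply (hk : Measurable (Function.uncurry k))
    (ha : ∀ i, Measurable fun ω => a ω i) (i j : Fin n) :
    Measurable fun ω => regGram k s (a ω) i j := by
  have h : Measurable fun ω => k (a ω i) (a ω j) := hk.comp ((ha i).prodMk (ha j))
  exact h.add (measurable_const (a := (s ^ 2 • (1 : Matrix (Fin n) (Fin n) ℝ)) i j))

lemma measurable_coef_apply (hk : Measurable (Function.uncurry k))
    (ha : ∀ i, Measurable fun ω => a ω i) {y : Ω → Fin n → ℝ}
    (hy : ∀ i, Measurable fun ω => y ω i) (i : Fin n) :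
    Measurable fun ω => coef k s (a ω) (y ω) i :=
  Finset.measurable_fun_sum Finset.univ fun j _ =>
    (measurable_inv_apply (measurable_regGram_apply hk ha) i j).mul (hy j)

lemma measurable_dotProduct {u v : Ω → Fin n → ℝ} (hu : ∀ i, Measurable fun ω => u ω i)
    (hv : ∀ i, Measurable fun ω => v ω i) : Measurable fun ω => u ω ⬝ᵥ v ω :=
  Finset.measurable_fun_sum _ fun j _ => (hu j).mul (hv j)

lemma measurable_kvec_apply (hk : Measurable (Function.uncurry k))
    (ha : ∀ i, Measurable fun ω => a ω i) {z : Ω → X} (hz : Measurable z) (i : Fin n) :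
    Measurable fun ω => kvec k (a ω) (z ω) i :=
  hk.comp ((ha i).prodMk hz)

lemma measurable_postMean (hk : Measurable (Function.uncurry k))
    (ha : ∀ i, Measurable fun ω => a ω i) {y : Ω → Fin n → ℝ}
    (hy : ∀ i, Measurable fun ω => y ω i) {z : Ω → X} (hz : Measurable z) :
    Measurable fun ω => postMean k s (a ω) (y ω) (z ω) :=
  measurable_dotProduct (measurable_kvec_apply hk ha hz) (measurable_coef_apply hk ha hy)

lemma measurable_postVar (hk : Measurable (Function.uncurry k))
    (ha : ∀ i, Measurable fun ω => a ω i) {z : Ω → X} (hz : Measurable z) :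
    Measurable fun ω => postVar k s (a ω) (z ω) :=
  (hk.comp (hz.prodMk hz)).sub (measurable_dotProduct (measurable_kvec_apply hk ha hz)
    (measurable_coef_apply hk ha (measurable_kvec_apply hk ha hz)))

lemma measurable_selfNorm (hk : Measurable (Function.uncurry k))
    (ha : ∀ i, Measurable fun ω => a ω i) {e : Ω → Fin n → ℝ}
    (he : ∀ i, Measurable fun ω => e ω i) :
    Measurable fun ω => selfNorm k s (a ω) (e ω) :=
  (measurable_dotProduct he he).sub
    ((measurable_dotProduct he (measurable_coef_apply hk ha he)).const_mul _)

lemma measurable_gainDet (hk : Measurable (Function.uncurry k))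
    (ha : ∀ i, Measurable fun ω => a ω i) (hs : 0 < s) :
    Measurable fun ω => gainDet k s (a ω) := by
  simp only [gainDet_eq hs]
  exact (measurable_det (measurable_regGram_apply hk ha)).const_mul _

end Measurability

/-! ### Self-normalised concentration; the regularisation `s` and the noise scale `σ` are kept
independent. -/

section Concentration

open scoped ENNReal

variable {X H : Type*} [NormedAddCommGroup H] [InnerProductSpace ℝ H] [MeasurableSpace X]
  {k : X → X → ℝ} {φ : X → H} {s σ : ℝ}
  {Ω : Type*} {mΩ : MeasurableSpace Ω} {P : Measure Ω} [IsProbabilityMeasure P]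
  {ℱ : Filtration ℕ mΩ} {x : ℕ → Ω → X} {ε : ℕ → Ω → ℝ} {T : ℕ}

/-- The first `n` noise variables along the outcome `ω`. -/
def noise {Ω : Type*} (ε : ℕ → Ω → ℝ) (n : ℕ) (ω : Ω) : Fin n → ℝ :=
  fun i => ε (i + 1) ω

/-- The method-of-mixtures supermartingale `exp (Z / (2 σ²)) / √det (I + s⁻² K)`. -/
noncomputable def mixture {Ω X : Type*} (k : X → X → ℝ) (s σ : ℝ) (x : ℕ → Ω → X) (ε : ℕ → Ω → ℝ)
    (n : ℕ) (ω : Ω) : ℝ :=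
  Real.exp (selfNorm k s (queries x n ω) (noise ε n ω) / (2 * σ ^ 2))
    / √(gainDet k s (queries x n ω))

omit [MeasurableSpace X] in
lemma queries_succ (x : ℕ → Ω → X) (n : ℕ) (ω : Ω) :
    queries x (n + 1) ω = append (queries x n ω) (x (n + 1) ω) := by
  refine (append_init _).symm.trans ?_
  simp [queries]
  rfl

lemma noise_succ (ε : ℕ → Ω → ℝ) (n : ℕ) (ω : Ω) :
    noise ε (n + 1) ω = append (noise ε n ω) (ε (n + 1) ω) := by
  refine (append_init _).symm.trans ?_
  simp [noise]
  rfl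

omit [MeasurableSpace X] in
lemma mixture_succ (hφ : IsFeature k φ) (hs : 0 < s) (x : ℕ → Ω → X) (ε : ℕ → Ω → ℝ) (n : ℕ)
    (ω : Ω) :
    mixture k s σ x ε (n + 1) ω = mixture k s σ x ε n ω
      * (Real.exp ((ε (n + 1) ω ^ 2
          - (ε (n + 1) ω - postMean k s (queries x n ω) (noise ε n ω) (x (n + 1) ω)) ^ 2
            / (1 + postVar k s (queries x n ω) (x (n + 1) ω) / s ^ 2)) / (2 * σ ^ 2))
        / √(1 + postVar k s (queries x n ω) (x (n + 1) ω) / s ^ 2)) := by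
  rw [mixture, queries_succ, noise_succ, selfNorm_append hφ hs, gainDet_append hφ hs, add_div,
    Real.exp_add, Real.sqrt_mul (zero_le_one.trans (one_le_gainDet hφ hs _)), mixture]
  exact (div_mul_div_comm _ _ _ _).symm

section

variable (hk : Measurable (Function.uncurry k))
  (hx : ∀ t ∈ Finset.Icc 1 T, Measurable[ℱ (t - 1)] (x t))
  (hε : IsCondSubGaussianNoise P ℱ σ ε T)
include hk hx hε

omit [IsProbabilityMeasure P] in
lemma measurable_mixture (hs : 0 < s) {n : ℕ} (hn : n ≤ T) :
    Measurable[ℱ n] (mixture k s σ x ε n) := by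
  have ha : ∀ i : Fin n, Measurable[ℱ n] fun ω => queries x n ω i := fun i =>
    (hx (i + 1) (Finset.mem_Icc.2 ⟨by omega, by omega⟩)).mono (ℱ.mono (by omega)) le_rfl
  have he : ∀ i : Fin n, Measurable[ℱ n] fun ω => noise ε n ω i := fun i =>
    (hε (i + 1) (Finset.mem_Icc.2 ⟨by omega, by omega⟩)).1.mono (ℱ.mono (by omega)) le_rfl
  exact ((measurable_selfNorm hk ha he).div_const _).exp.div (measurable_gainDet hk ha hs).sqrt

lemma lintegral_mixture_le_one (hφ : IsFeature k φ) (hs : 0 < s) (hσ : 0 < σ) {n : ℕ}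
    (hn : n ≤ T) : ∫⁻ ω, ENNReal.ofReal (mixture k s σ x ε n ω) ∂P ≤ 1 := by
  induction n with
  | zero => simp [mixture, gainDet_zero, selfNorm, dotProduct]
  | succ n ih =>
    refine le_trans ?_ (ih (by omega))
    have hmem : n + 1 ∈ Finset.Icc 1 T := Finset.mem_Icc.2 ⟨by omega, hn⟩
    have ha : ∀ i : Fin n, Measurable[ℱ n] fun ω => queries x n ω i := fun i =>
      (hx (i + 1) (Finset.mem_Icc.2 ⟨by omega, by omega⟩)).mono (ℱ.mono (by omega)) le_rfl
    have he : ∀ i : Fin n, Measurable[ℱ n] fun ω => noise ε n ω i := fun i =>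
      (hε (i + 1) (Finset.mem_Icc.2 ⟨by omega, by omega⟩)).1.mono (ℱ.mono (by omega)) le_rfl
    have hz : Measurable[ℱ n] (x (n + 1)) := hx (n + 1) hmem
    have h := lintegral_mul_mixture_le (σ := σ) (ξ := ε (n + 1)) (P := P) (ℱ.le n)
      ((hε (n + 1) hmem).1.mono (ℱ.le _) le_rfl) (hε (n + 1) hmem).2 hσ
      (measurable_mixture hk hx hε hs (by omega : n ≤ T)).ennreal_ofReal
      (measurable_postMean (s := s) hk ha he hz)
      ((measurable_postVar (s := s) hk ha hz).div_const (s ^ 2))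
      (fun ω => div_nonneg (postVar_nonneg hφ hs _ _) (sq_nonneg s))
    refine (lintegral_congr fun ω => ?_).trans_le h
    rw [mixture_succ hφ hs, ENNReal.ofReal_mul (by unfold mixture; positivity)]

/-- Self-normalised concentration at a fixed time. -/
lemma measure_selfNorm_gt_le (hφ : IsFeature k φ) (hs : 0 < s) (hσ : 0 < σ) {n : ℕ}
    (hn : n ≤ T) {δ : ℝ} (hδ : 0 < δ) :
    P {ω | Real.log (gainDet k s (queries x n ω)) - 2 * Real.log δ
        < selfNorm k s (queries x n ω) (noise ε n ω) / σ ^ 2} ≤ ENNReal.ofReal δ := by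
  have hm : Measurable fun ω => ENNReal.ofReal (mixture k s σ x ε n ω) :=
    ((measurable_mixture hk hx hε hs hn).mono (ℱ.le n) le_rfl).ennreal_ofReal
  have hmarkov := meas_ge_le_lintegral_div (μ := P) hm.aemeasurable
    (ε := ENNReal.ofReal δ⁻¹) (ENNReal.ofReal_pos.2 (by positivity)).ne' ENNReal.ofReal_ne_top
  refine (measure_mono fun ω hω => ?_).trans (hmarkov.trans ?_)
  · refine ENNReal.ofReal_le_ofReal ?_
    simp only [Set.mem_ofPred_eq] at hω
    have hD := one_le_gainDet hφ hs (queries x n ω)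
    have hD0 : 0 < gainDet k s (queries x n ω) := by linarith
    rw [mixture, le_div_iff₀ (Real.sqrt_pos.2 hD0), ← Real.exp_log (Real.sqrt_pos.2 hD0),
      ← Real.exp_log (inv_pos.2 hδ), ← Real.exp_add, Real.log_inv, Real.log_sqrt hD0.le]
    refine Real.exp_le_exp.2 ?_
    have : selfNorm k s (queries x n ω) (noise ε n ω) / (2 * σ ^ 2)
        = selfNorm k s (queries x n ω) (noise ε n ω) / σ ^ 2 / 2 := by
      rw [mul_comm, div_mul_eq_div_div]
    rw [this]
    linarith
  · refine (ENNReal.div_le_div_right (lintegral_mixture_le_one hk hx hε hφ hs hσ hn) _).trans ?_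
    rw [ENNReal.ofReal_inv_of_pos hδ, one_div, inv_inv]

end

end Concentration

end GPUCB

namespace GPUCB

/-! ### Tail bounds per round and the coverage event. -/

section Round

open scoped ENNReal

variable {X H : Type*} [NormedAddCommGroup H] [InnerProductSpace ℝ H] [MeasurableSpace X]
  {k : X → X → ℝ} {φ : X → H} {σ δ : ℝ}
  {Ω : Type*} {mΩ : MeasurableSpace Ω} {P : Measure Ω} [IsProbabilityMeasure P]
  {ℱ : Filtration ℕ mΩ} {x : ℕ → Ω → X} {ε : ℕ → Ω → ℝ} {T : ℕ}

/-- Two regimes: for `γ ≥ 1/16` mix at level `s = σ`; for smaller positive `γ` mix at `s² = 3γσ²`,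
so that the bound scales with `γ`. -/
lemma measure_selfNorm_gt_infoGain_le (hφ : IsFeature k φ) (hk1 : ∀ z z', k z z' ≤ 1)
    (hk : Measurable (Function.uncurry k))
    (hx : ∀ t ∈ Finset.Icc 1 T, Measurable[ℱ (t - 1)] (x t))
    (hε : IsCondSubGaussianNoise P ℱ σ ε T) (hσ : 0 < σ) (hδ : 0 < δ) (hδ1 : δ < 1)
    {n : ℕ} (hn1 : 1 ≤ n) (hn : n ≤ T) :
    P {ω | 150 * infoGain k σ (n + 1) * Real.log ((n + 1 : ℕ) / δ) ^ 3
        < selfNorm k σ (queries x n ω) (noise ε n ω) / σ ^ 2}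
      ≤ ENNReal.ofReal (δ / ((n + 1 : ℕ) : ℝ) ^ 2) := by
  set γ := infoGain k σ (n + 1) with hγ
  set N : ℝ := ((n + 1 : ℕ) : ℝ) with hN
  set L := Real.log (N / δ) with hL
  have hN2 : 2 ≤ N := by
    rw [hN]
    exact_mod_cast Nat.succ_le_succ hn1
  have hLN : L = Real.log N - Real.log δ := Real.log_div (by linarith) hδ.ne'
  have hlogδ : Real.log δ < 0 := Real.log_neg hδ hδ1
  -- `N ≥ 2` and `δ < 1` give `L ≥ log 2`; below, `0.476 ≤ 0.69²` makes the cube linear in `L`.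
  have hL2 : 0.69 ≤ L := by
    have h1 := Real.log_two_gt_d9
    have h2 := Real.log_le_log two_pos hN2
    rw [hLN]
    linarith
  have hδ' : -(2 * Real.log (δ / N ^ 2)) ≤ 4 * L := by
    rw [Real.log_div hδ.ne' (by positivity), Real.log_pow, hLN]
    push_cast
    linarith
  have hL3 : 0.476 * L ≤ L ^ 3 := by nlinarith [mul_self_nonneg (L - 0.69)]
  have : Nonempty X := ⟨x 0 (nonempty_of_isProbabilityMeasure P).some⟩
  have hγ0 : 0 ≤ γ := infoGain_nonneg hφ hk1 hσ _
  rcases le_total (1 / 16) γ with hγ1 | hγ1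
  · refine (measure_mono fun ω hω => ?_).trans
      (measure_selfNorm_gt_le (P := P) hk hx hε hφ hσ hσ hn (by positivity))
    have hω' : 150 * γ * L ^ 3 < selfNorm k σ (queries x n ω) (noise ε n ω) / σ ^ 2 := hω
    refine lt_of_le_of_lt ?_ hω'
    have h1 := half_log_gainDet_le_infoGain_succ hφ hk1 hσ (queries x n ω) (x (n + 1) ω)
    -- `150 γ L³ ≥ 71.4 γ L`, where `64 γ L ≥ 4L` and the remaining `7.4 γ L` exceeds `2γ`.
    nlinarith [mul_le_mul_of_nonneg_left hL3 hγ0]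
  · have htr : ∀ ω, ∑ i, k (queries x n ω i) (queries x n ω i) ≤ 3 * γ * σ ^ 2 := fun ω =>
      sum_diag_le_of_infoGain_le hφ hk1 hσ (queries x n ω) hγ1
    rcases hγ0.eq_or_lt with h0 | hpos
    · have hempty : {ω | 150 * γ * L ^ 3
          < selfNorm k σ (queries x n ω) (noise ε n ω) / σ ^ 2} = ∅ := by
        refine Set.eq_empty_of_forall_notMem fun ω hω => ?_
        have hk0 : ∀ i, 0 ≤ k (queries x n ω i) (queries x n ω i) := fun i => by
          rw [hφ]
          exact real_inner_self_nonneg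
        have hcomb : comb φ (queries x n ω) (noise ε n ω) = 0 := by
          refine Finset.sum_eq_zero fun i _ => ?_
          have h1 := (Finset.sum_eq_zero_iff_of_nonneg fun i _ => hk0 i).1
            (le_antisymm ((htr ω).trans_eq (by rw [← h0]; ring))
              (Finset.sum_nonneg fun i _ => hk0 i)) i (Finset.mem_univ i)
          rw [hφ, inner_self_eq_zero] at h1
          rw [h1, smul_zero]
        have h2 := selfNorm_le hφ hσ (queries x n ω) (noise ε n ω)
        rw [hcomb, norm_zero] at h2
        have h3 : selfNorm k σ (queries x n ω) (noise ε n ω) / σ ^ 2 ≤ 0 := by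
          refine div_nonpos_of_nonpos_of_nonneg ?_ (sq_nonneg σ)
          have : 0 < σ ^ 2 := by positivity
          nlinarith
        have h4 : 150 * γ * L ^ 3 < selfNorm k σ (queries x n ω) (noise ε n ω) / σ ^ 2 := hω
        rw [← h0] at h4
        linarith
      rw [hempty, measure_empty]
      exact zero_le
    · set s := √(3 * γ) * σ with hs
      have hs0 : 0 < s := by positivity
      have hs2 : s ^ 2 = 3 * γ * σ ^ 2 := by rw [hs, mul_pow, Real.sq_sqrt (by positivity)]
      refine (measure_mono fun ω hω => ?_).trans
        (measure_selfNorm_gt_le (P := P) hk hx hε hφ hs0 hσ hn (by positivity))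
      have hω' : 150 * γ * L ^ 3 < selfNorm k σ (queries x n ω) (noise ε n ω) / σ ^ 2 := hω
      change Real.log _ - _ < _
      have hD : Real.log (gainDet k s (queries x n ω)) ≤ 1 := by
        refine (log_gainDet_le hφ hs0 _).trans ?_
        rw [div_le_one (by positivity), hs2]
        exact htr ω
      set Z := selfNorm k σ (queries x n ω) (noise ε n ω)
      set Z' := selfNorm k s (queries x n ω) (noise ε n ω)
      have hZ' : 0 ≤ Z' := selfNorm_nonneg hφ hs0 _ _
      have hσ2 : 0 < σ ^ 2 := by positivity
      have hZZ : Z / σ ^ 2 ≤ 6 * γ * (Z' / σ ^ 2) := by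
        have h1 : σ ^ 2 * Z ≤ Z' * (s ^ 2 + ∑ i, k (queries x n ω i) (queries x n ω i)) :=
          (selfNorm_le hφ hσ _ _).trans (norm_comb_sq_le hφ hs0 _ _)
        have h2 : Z ≤ 6 * γ * Z' := by
          refine le_of_mul_le_mul_left (h1.trans ?_) hσ2
          rw [hs2]
          nlinarith [mul_le_mul_of_nonneg_left (htr ω) hZ']
        calc Z / σ ^ 2 ≤ 6 * γ * Z' / σ ^ 2 := by gcongr
          _ = _ := mul_div_assoc _ _ _
      have h3 : γ * (150 * L ^ 3) < γ * (6 * (Z' / σ ^ 2)) := by linarith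
      have h4 := lt_of_mul_lt_mul_left h3 hγ0
      -- What remains is `1 + 4L ≤ 25 L³`, which follows from `25 L³ ≥ 11.9 L` and `L ≥ 0.69`.
      linarith

/-- Telescoping with `1 / (n + 1)² ≤ 1 / n - 1 / (n + 1)`. The sum starts at `1 / 2²`, which is why
the total is at most `1`. -/
lemma sum_inv_sq_le (T : ℕ) : ∑ n ∈ Finset.Ico 1 T, 1 / ((n + 1 : ℕ) : ℝ) ^ 2 ≤ 1 := by
  rcases Nat.eq_zero_or_pos T with rfl | hT
  · simp
  have h : ∑ n ∈ Finset.Ico 1 T, 1 / ((n + 1 : ℕ) : ℝ) ^ 2 ≤ 1 - 1 / (T : ℝ) := by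
    induction T, hT using Nat.le_induction with
    | base => simp
    | succ T hT ih =>
      rw [Finset.sum_Ico_succ_top (by omega)]
      have hT0 : (0 : ℝ) < T := by exact_mod_cast hT
      have h1 : 1 / ((T + 1 : ℕ) : ℝ) ^ 2 ≤ 1 / (T : ℝ) - 1 / ((T + 1 : ℕ) : ℝ) := by
        push_cast
        rw [div_sub_div _ _ hT0.ne' (by positivity), div_le_div_iff₀ (by positivity)
          (by positivity)]
        nlinarith
      linarith
  have : 0 ≤ 1 / (T : ℝ) := by positivity
  linarith

omit [MeasurableSpace X] in
lemma mem_coverageSet (hφ : IsFeature k φ) (hσ : 0 < σ) {g : H} {f : X → ℝ}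
    (hf : ∀ z, f z = inner ℝ g (φ z)) {B γL : ℝ} (hB : ‖g‖ ≤ B) {β : ℕ → ℝ} {n : ℕ}
    (hβ : 2 * B ^ 2 + 2 * γL ≤ β (n + 1)) {ω : Ω}
    (hZ : selfNorm k σ (queries x n ω) (noise ε n ω) / σ ^ 2 ≤ γL) (z : X) :
    f z ∈ coverageSet k σ β f x ε (n + 1) ω z := by
  have h := abs_sub_postMean_le hφ hσ (queries x n ω) (noise ε n ω) g z
  have hobs : observations f x ε n ω
      = fun i => inner ℝ g (φ (queries x n ω i)) + noise ε n ω i := by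
    ext i
    rw [observations, hf]
    rfl
  change |f z - postMean k σ (queries x n ω) (observations f x ε n ω) z| ≤ _
  rw [hobs, hf]
  refine h.trans (mul_le_mul_of_nonneg_right ?_ (Real.sqrt_nonneg _))
  refine Real.le_sqrt_of_sq_le ?_
  set Z := selfNorm k σ (queries x n ω) (noise ε n ω)
  have hsq : (√Z / σ) ^ 2 = Z / σ ^ 2 := by
    rw [div_pow, Real.sq_sqrt (selfNorm_nonneg hφ hσ _ _)]
  have hB2 : ‖g‖ ^ 2 ≤ B ^ 2 := by gcongr
  nlinarith [sq_nonneg (‖g‖ - √Z / σ)]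

omit [IsProbabilityMeasure P] in
lemma IsCondSubGaussianNoise.mono {R : ℝ} (hε : IsCondSubGaussianNoise P ℱ R ε T) (hR : 0 ≤ R)
    (hRσ : R ≤ σ) : IsCondSubGaussianNoise P ℱ σ ε T := fun t ht =>
  ⟨(hε t ht).1, fun η => ⟨((hε t ht).2 η).1, ((hε t ht).2 η).2.trans
    (Filter.Eventually.of_forall fun _ => Real.exp_le_exp.2 (by gcongr))⟩⟩

omit [MeasurableSpace X] in
lemma coverage_eq_one {β : ℕ → ℝ} {f : X → ℝ} {ω : Ω} (hT : 1 ≤ T)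
    (h : ∀ t ∈ Finset.Icc 1 T, f (x t ω) ∈ coverageSet k σ β f x ε t ω (x t ω)) :
    coverage k σ β f x ε T ω = 1 := by
  have hT0 : (T : ℝ) ≠ 0 := by positivity
  rw [coverage, Finset.sum_congr rfl fun t ht => Set.indicator_of_mem (h t ht) _]
  simp [hT0]

end Round

end GPUCB

/-! ### Assembly: canonical features and the union bound. -/

theorem mainTheorem5 {d : ℕ} (X : Set (EuclideanSpace ℝ (Fin d))) (hX : IsCompact X)
    -- a kernel `k ≤ 1` on `X` and its reproducing kernel Hilbert space `H`
    (k : X → X → ℝ) (hk_meas : Measurable (Function.uncurry k)) (hk_le : ∀ z z', k z z' ≤ 1)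
    {H : Type*} [NormedAddCommGroup H] [InnerProductSpace ℝ H] [CompleteSpace H] [RKHS ℝ H X ℝ]
    (hk : ∀ z z', RKHS.kernel H z z' 1 = k z z')
    (f : H) (B : ℝ) (hf : ‖f‖ ≤ B)
    -- noise model `σ²`, sub-Gaussian constant `R`, confidence level `δ`, exploration scale `β`
    (σ R δ : ℝ) (hσ : 0 < σ) (hR : 0 ≤ R) (hRσ : R ≤ σ) (hδ : 0 < δ) (hδ1 : δ < 1)
    (T : ℕ) (hT : 1 ≤ T)
    (β : ℕ → ℝ) (hβ : ∀ t ∈ Finset.Icc 1 T, GPUCB.ucbScale k σ B δ t ≤ β t)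
    -- a run of GP-UCB with the fixed kernel `k` for `T` rounds
    {Ω : Type*} {mΩ : MeasurableSpace Ω} (P : Measure Ω) [IsProbabilityMeasure P]
    (ℱ : Filtration ℕ mΩ) (x : ℕ → Ω → X) (ε : ℕ → Ω → ℝ)
    (hx : ∀ t ∈ Finset.Icc 1 T, Measurable[ℱ (t - 1)] (x t))
    (hε : GPUCB.IsCondSubGaussianNoise P ℱ R ε T)
    (hucb : GPUCB.IsUCBRun k σ β (fun z => f z) x ε T) :
    ENNReal.ofReal (1 - δ) ≤
      P {ω | 1 - δ ≤ GPUCB.coverage k σ β (fun z => f z) x ε T ω} := by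
  let φ : X → H := fun z => RKHS.kerFun H z 1
  have hφ : GPUCB.IsFeature k φ := fun z z' => by
    rw [← hk, RKHS.kerFun_inner, RKHS.kerFun_apply]
    simp
  have hf' : ∀ z, f z = inner ℝ f (φ z) := fun z => by
    rw [RKHS.inner_kerFun]
    simp
  have hε' := hε.mono hR hRσ
  let bad : ℕ → Set Ω := fun n =>
    {ω | 150 * GPUCB.infoGain k σ (n + 1) * Real.log ((n + 1 : ℕ) / δ) ^ 3
      < GPUCB.selfNorm k σ (GPUCB.queries x n ω) (GPUCB.noise ε n ω) / σ ^ 2}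
  have hbad : P (⋃ n ∈ Finset.Ico 1 T, bad n) ≤ ENNReal.ofReal δ := by
    calc P (⋃ n ∈ Finset.Ico 1 T, bad n) ≤ ∑ n ∈ Finset.Ico 1 T, P (bad n) :=
          measure_biUnion_finset_le _ _
      _ ≤ ∑ n ∈ Finset.Ico 1 T, ENNReal.ofReal (δ / ((n + 1 : ℕ) : ℝ) ^ 2) :=
          Finset.sum_le_sum fun n hn =>
            GPUCB.measure_selfNorm_gt_infoGain_le hφ hk_le hk_meas hx hε' hσ hδ hδ1
              (Finset.mem_Ico.1 hn).1 (Finset.mem_Ico.1 hn).2.le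
      _ = ENNReal.ofReal (δ * ∑ n ∈ Finset.Ico 1 T, 1 / ((n + 1 : ℕ) : ℝ) ^ 2) := by
          rw [← ENNReal.ofReal_sum_of_nonneg fun n _ => by positivity, Finset.mul_sum]
          simp only [mul_one_div]
      _ ≤ ENNReal.ofReal δ :=
          ENNReal.ofReal_le_ofReal (mul_le_of_le_one_right hδ.le (GPUCB.sum_inv_sq_le T))
  have hgood : (⋃ n ∈ Finset.Ico 1 T, bad n)ᶜ
      ⊆ {ω | 1 - δ ≤ GPUCB.coverage k σ β (fun z => f z) x ε T ω} := by
    intro ω hω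
    have hcov : GPUCB.coverage k σ β (fun z => f z) x ε T ω = 1 := by
      refine GPUCB.coverage_eq_one hT fun t ht => ?_
      obtain ⟨n, rfl⟩ : ∃ n, t = n + 1 := ⟨t - 1, by have := (Finset.mem_Icc.1 ht).1; omega⟩
      refine GPUCB.mem_coverageSet hφ hσ hf' (B := B)
        (γL := 150 * GPUCB.infoGain k σ (n + 1) * Real.log ((n + 1 : ℕ) / δ) ^ 3) hf
        (le_trans (le_of_eq ?_) (hβ (n + 1) ht)) ?_ _
      · rw [GPUCB.ucbScale]
        ring
      -- The first round has no data, so `Z = 0` and it costs no probability.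
      · rcases Nat.eq_zero_or_pos n with rfl | hn
        · have : Nonempty X := ⟨x 0 ω⟩
          have hγ := GPUCB.infoGain_nonneg hφ hk_le hσ 1
          have hL : 0 ≤ Real.log ((0 + 1 : ℕ) / δ) := by
            refine Real.log_nonneg ?_
            rw [le_div_iff₀ hδ]
            simpa using hδ1.le
          have hZ : GPUCB.selfNorm k σ (GPUCB.queries x 0 ω) (GPUCB.noise ε 0 ω) = 0 := by
            simp [GPUCB.selfNorm, dotProduct]
          rw [hZ, zero_div]
          positivity
        · by_contra hlt
          refine hω (Set.mem_biUnion (x := n) ?_ (not_le.1 hlt))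
          exact Finset.mem_coe.2 (Finset.mem_Ico.2 ⟨hn, (Finset.mem_Icc.1 ht).2⟩)
    change 1 - δ ≤ _
    rw [hcov]
    linarith
  rw [ENNReal.ofReal_sub _ hδ.le, ENNReal.ofReal_one, tsub_le_iff_right]
  calc 1 = P Set.univ := measure_univ.symm
    _ = P ((⋃ n ∈ Finset.Ico 1 T, bad n)ᶜ ∪ ⋃ n ∈ Finset.Ico 1 T, bad n) := by
        rw [Set.compl_union_self]
    _ ≤ P (⋃ n ∈ Finset.Ico 1 T, bad n)ᶜ + P (⋃ n ∈ Finset.Ico 1 T, bad n) := measure_union_le _ _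
    _ ≤ _ := add_le_add (measure_mono hgood) hbad
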